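/- **Setting.** Let $G=(V,E,u,s,t,c)$ be a finite directed network (parallel arcs and loops allowed) whose underlying undirected graph is connected, with capacities $u(e)\in\{0,1,2,\dots\}$ for $e\in E$, a source $s$ and a sink $t\ne s$, and interdiction costs $c(p)\in\{1,2,\dots\}\cup\{\infty\}$ for $p\in V\cup E$, where $c(s)=c(t)=\infty$. Let $G$ be embedded in the (oriented) sphere, and let $B\in\{0,1,2,\dots\}$. An *interdiction set* for the budget $B$ is a set $R\subseteq V\cup E$ with $\sum_{r\in R}c(r)\le B$. $G\setminus R$ is obtained by removing the arcs and vertices in $R$ and all arcs adjacent to removed vertices, and $\nu^{\max}(G\setminus R)$ is the value of a maximum $s$-$t$ flow in it. **Modified dual.** The directed multigraph $\widetilde{G^*}$ has as vertices the faces of the embedding and the vertices of $G$. Its arcs, with lengths $\widetilde{\lambda^*}$ and costs $\widetilde{c^*}$, are: * for every $e\in E$ the dual arc $e^D$, which crosses $e$ from the face on its right to the face on its left, with $\widetilde{\lambda^*}(e^D)=u(e)$ and $\widetilde{c^*}(e^D)=c(e)$, and its reverse $e^D_R$, with $\widetilde{\lambda^*}(e^D_R)=0$ and $\widetilde{c^*}(e^D_R)=0$;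 * for every incidence (corner) of a vertex $v\in V$ with a face $v^*$ an arc $(v^*,v)$ of length $\infty$ and cost $c(v)$, and an arc $(v,v^*)$ of length $\infty$ and cost $0$, both drawn through that corner. (A face that touches $v$ at several corners gives one such pair for each corner.) For a set $U$ of arcs of $\widetilde{G^*}$ the *reduced length* is $$\widetilde{\lambda^*_B}(U)=\min\Big\{\sum_{a\in U\setminus X}\widetilde{\lambda^*}(a)\ \Big|\ X\subseteq U,\ \sum_{a\in X}\widetilde{c^*}(a)\le B\Big\}.$$ A *circuit* is (the arc set of) a directed closed walk with at least one arc that repeats no vertex. It is *$s$-$t$ separating counterclockwise* if it passes through neither $s$ nor $t$, the component of the sphere minus the circuit that contains $s$ lies to the left of the circuit, and $t$ is not in that component. **Theorem.** 1. For every interdiction set $R\subseteq V\cup E$ for the budget $B$ there is an $s$-$t$ separating counterclockwise circuit $\widetilde{\mathcal C^*}$ in $\widetilde{G^*}$ with $\widetilde{\lambda^*_B}(\widetilde{\mathcal C^*})\le\nu^{\max}(G\setminus R)$. 2. For every $s$-$t$ separating counterclockwise circuit $\widetilde{\mathcal C^*}$ in $\widetilde{G^*}$ there is an interdiction set $R\subseteq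 V\cup E$ for the budget $B$ with $\nu^{\max}(G\setminus R)\le\widetilde{\lambda^*_B}(\widetilde{\mathcal C^*})$. -/

import Mathlib

open scoped ENNReal

/-- A finite directed multigraph with capacities `u`, a source `s` and a sink `t`. -/
structure FlowNetwork (V E : Type*) where
  tail : E → V
  head : E → V
  u : E → ℕ
  s : V
  t : V
  s_ne_t : s ≠ t

namespace FlowNetwork

section Flows

variable {V E : Type*} [Fintype E] [DecidableEq V] (N : FlowNetwork V E)

/-- The arcs exiting the vertex `v`. -/
def outArcs (v : V) : Finset E :=
  Finset.univ.filter fun e => N.tail e = v ∧ N.head e ≠ v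

/-- The arcs entering the vertex `v`. -/
def inArcs (v : V) : Finset E :=
  Finset.univ.filter fun e => N.head e = v ∧ N.tail e ≠ v

/-- Outflow minus inflow at `v`. -/
def excess (f : E → ℝ) (v : V) : ℝ :=
  ∑ e ∈ N.outArcs v, f e - ∑ e ∈ N.inArcs v, f e

/-- An `s`-`t` flow. -/
structure IsFlow (f : E → ℝ) : Prop where
  nonneg : ∀ e, 0 ≤ f e
  le_capacity : ∀ e, f e ≤ N.u e
  conservation : ∀ v, v ≠ N.s → v ≠ N.t → N.excess f v = 0
  source_nonneg : 0 ≤ N.excess f N.s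

/-- The value of a maximum `s`-`t` flow; the set of flow values is nonempty and bounded. -/
noncomputable def maxFlow : ℝ :=
  sSup {x : ℝ | ∃ f : E → ℝ, N.IsFlow f ∧ N.excess f N.s = x}

theorem isFlow_zero : N.IsFlow fun _ => 0 :=
  ⟨fun _ => le_rfl, fun _ => Nat.cast_nonneg _, fun _ _ _ => by simp [excess],
    by simp [excess]⟩

theorem flowValues_nonempty : {x : ℝ | ∃ f : E → ℝ, N.IsFlow f ∧ N.excess f N.s = x}.Nonempty :=
  ⟨_, _, N.isFlow_zero, rfl⟩

theorem flowValues_bddAbove :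
    BddAbove {x : ℝ | ∃ f : E → ℝ, N.IsFlow f ∧ N.excess f N.s = x} := by
  refine ⟨∑ e ∈ N.outArcs N.s, (N.u e : ℝ), ?_⟩
  rintro x ⟨f, hf, rfl⟩
  have h1 : ∑ e ∈ N.outArcs N.s, f e ≤ ∑ e ∈ N.outArcs N.s, (N.u e : ℝ) :=
    Finset.sum_le_sum fun e _ => hf.le_capacity e
  have h2 : 0 ≤ ∑ e ∈ N.inArcs N.s, f e := Finset.sum_nonneg fun e _ => hf.nonneg e
  unfold excess
  linarith

end Flows

variable {V E : Type*}

/-- The underlying undirected graph is connected. -/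
def Connected (N : FlowNetwork V E) : Prop :=
  ∀ v w : V, Relation.EqvGen (fun a b => ∃ e, N.tail e = a ∧ N.head e = b) v w

/-- The half-edges: `(e, false)` is the half of `e` at its tail, `(e, true)` the half of `e` at
its head. Both are thought of as pointing away from the end at which they are attached. -/
abbrev Dart (E : Type*) := E × Bool

/-- The vertex at which a half-edge is attached. -/
def vert (N : FlowNetwork V E) (d : Dart E) : V := if d.2 then N.head d.1 else N.tail d.1

/-- The other half of the same arc. -/
def opp : Equiv.Perm (Dart E) := Equiv.prodCongr (Equiv.refl E) Equiv.boolNot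

/-- The permutation that walks around the faces determined by a rotation system `rot`, keeping the
face on the left: follow `d` to its other end and take there the next half-edge in clockwise
order. -/
def facePerm (rot : Equiv.Perm (Dart E)) : Equiv.Perm (Dart E) := rot⁻¹ * opp

/-- A planar embedding, up to homeomorphism of the oriented sphere, of a connected network with at
least one arc, as a rotation system of genus zero: `rot d` is the half-edge that follows `d` in
counterclockwise order around the vertex `N.vert d`. The faces are the cycles of `facePerm rot`,
and Euler's formula `|V| - |E| + |F| = 2` says that the surface is the sphere. -/
structure PlanarEmbedding (N : FlowNetwork V E) where
  rot : Equiv.Perm (Dart E)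
  sameCycle_iff : ∀ d d' : Dart E, rot.SameCycle d d' ↔ N.vert d = N.vert d'
  euler : Nat.card V + Nat.card (Quotient (Equiv.Perm.SameCycle.setoid (facePerm rot)))
    = Nat.card E + 2

end FlowNetwork

/-- A flow network in which arcs and vertices have interdiction costs in `{1, 2, …} ∪ {∞}`. -/
structure InterdictionNetwork (V E : Type*) extends FlowNetwork V E where
  c : V ⊕ E → ℕ∞
  one_le_c : ∀ p, 1 ≤ c p
  c_s : c (Sum.inl s) = ⊤
  c_t : c (Sum.inl t) = ⊤

namespace InterdictionNetwork

variable {V E : Type*} (G : InterdictionNetwork V E)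

/-- `R` respects the budget `B`. -/
def IsInterdictionSet (B : ℕ) (R : Finset (V ⊕ E)) : Prop := ∑ r ∈ R, G.c r ≤ (B : ℕ∞)

theorem IsInterdictionSet.notMem_of_cost {G : InterdictionNetwork V E} {B : ℕ}
    {R : Finset (V ⊕ E)} (h : G.IsInterdictionSet B R) {p : V ⊕ E} (hp : G.c p = ⊤) : p ∉ R := by
  intro hmem
  have h1 : G.c p ≤ ∑ r ∈ R, G.c r :=
    Finset.single_le_sum (f := G.c) (fun _ _ => zero_le) hmem
  have h2 : (⊤ : ℕ∞) ≤ B := hp ▸ h1.trans h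
  exact ENat.natCast_ne_top B (top_le_iff.mp h2)

theorem IsInterdictionSet.s_notMem {G : InterdictionNetwork V E} {B : ℕ}
    {R : Finset (V ⊕ E)} (h : G.IsInterdictionSet B R) : Sum.inl G.s ∉ R :=
  h.notMem_of_cost G.c_s

theorem IsInterdictionSet.t_notMem {G : InterdictionNetwork V E} {B : ℕ}
    {R : Finset (V ⊕ E)} (h : G.IsInterdictionSet B R) : Sum.inl G.t ∉ R :=
  h.notMem_of_cost G.c_t

/-- The vertices of `G ∖ R`. -/
abbrev RemainingVertex (_G : InterdictionNetwork V E) (R : Finset (V ⊕ E)) :=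
  {v : V // Sum.inl v ∉ R}

/-- The arcs of `G ∖ R`: not removed themselves, and with both ends not removed. -/
abbrev RemainingArc (R : Finset (V ⊕ E)) :=
  {e : E // Sum.inr e ∉ R ∧ Sum.inl (G.tail e) ∉ R ∧ Sum.inl (G.head e) ∉ R}

/-- The flow network `G ∖ R`. -/
def remove (R : Finset (V ⊕ E)) (hs : Sum.inl G.s ∉ R) (ht : Sum.inl G.t ∉ R) :
    FlowNetwork (G.RemainingVertex R) (G.RemainingArc R) where
  tail e := ⟨G.tail e.1, e.2.2.1⟩
  head e := ⟨G.head e.1, e.2.2.2⟩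
  u e := G.u e.1
  s := ⟨G.s, hs⟩
  t := ⟨G.t, ht⟩
  s_ne_t h := G.s_ne_t (congrArg Subtype.val h)

end InterdictionNetwork

open FlowNetwork in
/-- The arcs of the modified dual. `dual e` and `dualRev e` are the dual arc of `e` and its reverse.
The corners of the embedding (the incidences of a vertex with a face) are indexed by the
half-edges: the corner of `d` is the sector between `d` and its counterclockwise successor. For each
corner, `enter d` leads from the face to the vertex and `leave d` from the vertex to the face. -/
inductive ModArc (E : Type*) where
  | dual (e : E)
  | dualRev (e : E)
  | enter (d : Dart E)
  | leave (d : Dart E)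

namespace FlowNetwork

/-- The set `C` of arcs of the modified dual passes through the vertex `v` of the network. -/
def Visits {V E : Type*} (N : FlowNetwork V E) (C : Finset (ModArc E)) (v : V) : Prop :=
  ∃ d, N.vert d = v ∧ (ModArc.enter d ∈ C ∨ ModArc.leave d ∈ C)

end FlowNetwork

namespace FlowNetwork.PlanarEmbedding

variable {V E : Type*} {N : FlowNetwork V E} (M : N.PlanarEmbedding)

/-- The faces of the embedding. -/
def Face : Type _ := Quotient (Equiv.Perm.SameCycle.setoid (facePerm M.rot))

/-- The face to the left of a half-edge; it contains the corner of that half-edge. -/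
def leftFace (d : Dart E) : M.Face := Quotient.mk (Equiv.Perm.SameCycle.setoid (facePerm M.rot)) d

/-- The start of an arc of the modified dual. Its vertices are the faces and the vertices of the
network, and dual arcs cross the original arc from right to left. -/
def arcTail : ModArc E → M.Face ⊕ V
  | .dual e => Sum.inl (M.leftFace (e, true))
  | .dualRev e => Sum.inl (M.leftFace (e, false))
  | .enter d => Sum.inl (M.leftFace d)
  | .leave d => Sum.inr (N.vert d)

/-- The end of an arc of the modified dual. -/
def arcHead : ModArc E → M.Face ⊕ V
  | .dual e => Sum.inl (M.leftFace (e, false))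
  | .dualRev e => Sum.inl (M.leftFace (e, true))
  | .enter d => Sum.inr (N.vert d)
  | .leave d => Sum.inl (M.leftFace d)

/-- `C` is the arc set of a directed circuit of the modified dual: a closed walk (of length at
least one) that repeats no vertex. The index `i + 1` is taken modulo `k + 1`. -/
def IsCircuit (C : Finset (ModArc E)) : Prop :=
  ∃ (k : ℕ) (a : Fin (k + 1) → ModArc E),
    Function.Injective (fun i => M.arcTail (a i)) ∧
    (∀ i, M.arcHead (a i) = M.arcTail (a (i + 1))) ∧
    (C : Set (ModArc E)) = Set.range a

/-- `C` separates neither the two halves of an arc that it does not cross, nor two half-edges that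
are consecutive around a vertex if `C` does not run through the corner between them. -/
def Adjacent (C : Finset (ModArc E)) (d d' : Dart E) : Prop :=
  (d' = opp d ∧ ModArc.dual d.1 ∉ C ∧ ModArc.dualRev d.1 ∉ C) ∨
  (d' = M.rot d ∧ ModArc.enter d ∉ C ∧ ModArc.leave d ∉ C)

/-- Two half-edges lie in the same component of the sphere minus the closed curve `C`. (The curve
crosses arcs at their midpoints, so that it is disjoint from all open half-edges.) -/
def SameSide (C : Finset (ModArc E)) : Dart E → Dart E → Prop :=
  Relation.EqvGen (M.Adjacent C)

/-- The half-edge `d` lies immediately to the left of an arc of `C`. -/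
def BordersLeft (C : Finset (ModArc E)) (d : Dart E) : Prop :=
  (ModArc.dual d.1 ∈ C ∧ d.2 = false) ∨
  (ModArc.dualRev d.1 ∈ C ∧ d.2 = true) ∨
  ModArc.enter d ∈ C ∨
  ModArc.leave (M.rot⁻¹ d) ∈ C

/-- The vertex `v` is not on `C`, and it is surrounded by `C` in counterclockwise sense: the
component of the sphere minus `C` that contains `v` lies to the left of `C`. -/
def SurroundsCCW (C : Finset (ModArc E)) (v : V) : Prop :=
  ¬ N.Visits C v ∧ ∃ d d', N.vert d = v ∧ M.BordersLeft C d' ∧ M.SameSide C d d'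

/-- The vertices `v` and `w` are not on `C`, and `C` separates them. -/
def Separates (C : Finset (ModArc E)) (v w : V) : Prop :=
  ¬ N.Visits C v ∧ ¬ N.Visits C w ∧
    ∀ d d', N.vert d = v → N.vert d' = w → ¬ M.SameSide C d d'

/-- `s`-`t` separating counterclockwise circuits of the modified dual. -/
def IsSTSeparatingCCW (C : Finset (ModArc E)) : Prop :=
  M.IsCircuit C ∧ M.SurroundsCCW C N.s ∧ M.Separates C N.s N.t

end FlowNetwork.PlanarEmbedding

namespace InterdictionNetwork

variable {V E : Type*} (G : InterdictionNetwork V E)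

/-- The length function of the modified dual. -/
def modLength : ModArc E → ℕ∞
  | .dual e => (G.u e : ℕ∞)
  | .dualRev _ => 0
  | .enter _ => ⊤
  | .leave _ => ⊤

/-- The interdiction costs of the modified dual. -/
def modCost : ModArc E → ℕ∞
  | .dual e => G.c (Sum.inr e)
  | .dualRev _ => 0
  | .enter d => G.c (Sum.inl (G.vert d))
  | .leave _ => 0

open scoped Classical in
/-- The reduced length of a set of arcs with respect to the budget `B`. -/
noncomputable def reducedLength (B : ℕ) (U : Finset (ModArc E)) : ℕ∞ :=
  sInf {L : ℕ∞ | ∃ X ⊆ U, ∑ a ∈ X, G.modCost a ≤ (B : ℕ∞) ∧ L = ∑ a ∈ U \ X, G.modLength a}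

end InterdictionNetwork

/-!
A cut of the network corresponds to a closed curve in the modified dual, and interdiction shortens
both: removing an arc or a vertex is the same as not paying for crossing it.

The topology is handled by functions `χ` on darts. Every arc `a` of the modified dual has a dart on
its left (`leftDart a`) and one on its right, and `jump χ a` is the difference of the two values.
Summation by parts around faces and vertices (`sum_jump_mul_arcHead`) shows that the jumps of any
`χ` form a circulation in the modified dual. Conversely, every circulation consists of the jumps of
some `χ` (`exists_potential`). This is the only place where planarity enters: jumps are orthogonal
to gradients of functions on the vertices of the modified dual, and by Euler's formula the two
spaces have complementary dimensions, `2|E| - 1` and `|V| + |F| - 1 = |E| + 1` out of `3|E|`. In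
particular a circuit `C` has a potential, a function that increases by one from right to left of
`C` and changes nowhere else.

From an interdiction set to a circuit (`exists_circuit_le_maxFlow`): a minimum cut of `G ∖ R`
(`exists_cut_le_maxFlow`) determines a set of darts whose boundary in the modified dual runs only
through removed vertices, removed arcs and arcs of the cut. The boundary decomposes into circuits,
and the potentials of these add up to the indicator function of the set, up to a constant, and this
function is larger at `s` than at `t`. Hence one of the circuits has a potential that is larger
at `s` than at `t`
(`IsPotential.exists_circuit_lt`), and such a circuit separates `s` from `t` and surrounds `s`
counterclockwise (`IsCircuit.isSTSeparatingCCW`).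

From a circuit to an interdiction set (`exists_interdictionSet_maxFlow_le`): a function that changes
only across the arcs of a circuit has the same jump across all of them (`IsCircuit.jump_eq`).
Applied to the indicator function of the component of `s`, this shows that every arc of a separating
counterclockwise circuit has that component on its left and not on its right
(`IsSTSeparatingCCW.sides`). After removal of the arcs and vertices that the budget pays for, an
arc that leaves the component is therefore crossed by an unpaid dual arc of the circuit, and the
length of these bounds the maximum flow.
-/

/-! ### Maximum flows and minimum cuts -/

namespace FlowNetwork

section Cuts

variable {V E : Type*} [Fintype E] [DecidableEq V] (N : FlowNetwork V E)

theorem excess_eq_sum (f : E → ℝ) (v : V) :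
    N.excess f v =
      ∑ e, f e * ((if N.tail e = v then 1 else 0) - (if N.head e = v then 1 else 0)) := by
  unfold excess outArcs inArcs
  rw [Finset.sum_filter, Finset.sum_filter, ← Finset.sum_sub_distrib]
  refine Finset.sum_congr rfl fun e _ => ?_
  by_cases h1 : N.tail e = v <;> by_cases h2 : N.head e = v <;> simp [h1, h2]

theorem sum_excess (f : E → ℝ) (S : Finset V) :
    ∑ v ∈ S, N.excess f v =
      ∑ e, f e * ((if N.tail e ∈ S then 1 else 0) - (if N.head e ∈ S then 1 else 0)) := by
  simp only [excess_eq_sum]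
  rw [Finset.sum_comm]
  refine Finset.sum_congr rfl fun e _ => ?_
  rw [← Finset.mul_sum, Finset.sum_sub_distrib]
  simp

/-- The arcs that leave the vertex set `S`. -/
def cutArcs (S : Finset V) : Finset E :=
  Finset.univ.filter fun e => N.tail e ∈ S ∧ N.head e ∉ S

variable {N}

theorem IsFlow.excess_source_eq {f : E → ℝ} (hf : N.IsFlow f) {S : Finset V} (hs : N.s ∈ S)
    (ht : N.t ∉ S) : N.excess f N.s =
      ∑ e, f e * ((if N.tail e ∈ S then 1 else 0) - (if N.head e ∈ S then 1 else 0)) := by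
  rw [← sum_excess]
  refine (Finset.sum_eq_single_of_mem _ hs fun v hv hvs => hf.conservation v hvs ?_).symm
  rintro rfl
  exact ht hv

theorem IsFlow.excess_source_le_cut {f : E → ℝ} (hf : N.IsFlow f) {S : Finset V} (hs : N.s ∈ S)
    (ht : N.t ∉ S) : N.excess f N.s ≤ ∑ e ∈ N.cutArcs S, (N.u e : ℝ) := by
  rw [hf.excess_source_eq hs ht, cutArcs, Finset.sum_filter]
  refine Finset.sum_le_sum fun e _ => ?_
  have h0 := hf.nonneg e
  have h1 := hf.le_capacity e
  by_cases ha : N.tail e ∈ S <;> by_cases hb : N.head e ∈ S <;> simp [ha, hb] <;> linarith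

theorem maxFlow_le_cut {S : Finset V} (hs : N.s ∈ S) (ht : N.t ∉ S) :
    N.maxFlow ≤ ∑ e ∈ N.cutArcs S, (N.u e : ℝ) := by
  refine csSup_le N.flowValues_nonempty ?_
  rintro x ⟨f, hf, rfl⟩
  exact hf.excess_source_le_cut hs ht

theorem IsFlow.excess_source_le_maxFlow {f : E → ℝ} (hf : N.IsFlow f) :
    N.excess f N.s ≤ N.maxFlow :=
  le_csSup N.flowValues_bddAbove ⟨f, hf, rfl⟩

variable (N)

theorem continuous_excess (v : V) : Continuous fun f : E → ℝ => N.excess f v := by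
  unfold excess
  fun_prop

theorem exists_isFlow_excess_eq_maxFlow : ∃ f : E → ℝ, N.IsFlow f ∧ N.excess f N.s = N.maxFlow := by
  have hset : {f : E → ℝ | N.IsFlow f} = Set.pi Set.univ (fun e => Set.Icc 0 (N.u e : ℝ)) ∩
      ({f | ∀ v, v ≠ N.s → v ≠ N.t → N.excess f v = 0} ∩ {f | 0 ≤ N.excess f N.s}) := by
    ext f
    simp only [Set.mem_ofPred_eq, Set.mem_inter_iff, Set.mem_pi, Set.mem_univ, Set.mem_Icc,
      true_implies]
    exact ⟨fun h => ⟨fun e => ⟨h.nonneg e, h.le_capacity e⟩, h.conservation, h.source_nonneg⟩,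
      fun h => ⟨fun e => (h.1 e).1, fun e => (h.1 e).2, h.2.1, h.2.2⟩⟩
  have hcomp : IsCompact {f : E → ℝ | N.IsFlow f} := by
    rw [hset]
    refine (isCompact_univ_pi fun _ => isCompact_Icc).inter_right (IsClosed.inter ?_ ?_)
    · simp only [Set.ofPred_forall]
      exact isClosed_iInter fun v => isClosed_iInter fun _ => isClosed_iInter fun _ =>
        isClosed_eq (N.continuous_excess v) continuous_const
    · exact isClosed_le continuous_const (N.continuous_excess _)
  obtain ⟨f, hf, hmax⟩ := hcomp.exists_isMaxOn ⟨_, N.isFlow_zero⟩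
    (N.continuous_excess N.s).continuousOn
  refine ⟨f, hf, le_antisymm hf.excess_source_le_maxFlow (csSup_le N.flowValues_nonempty ?_)⟩
  rintro x ⟨g, hg, rfl⟩
  exact hmax hg

/-- One step in the residual network of `f`: along an unsaturated arc, or backwards along an arc
that carries flow. -/
def ResidualStep (f : E → ℝ) (v w : V) : Prop :=
  (∃ e, N.tail e = v ∧ N.head e = w ∧ f e < N.u e) ∨
    ∃ e, N.head e = v ∧ N.tail e = w ∧ 0 < f e

/-- Feasible directions at `f` form a cone, so that an augmenting direction can be assembled one
residual arc at a time, without keeping track of a simple augmenting path. -/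
theorem exists_direction_of_reachable {f : E → ℝ} {v : V}
    (hv : Relation.ReflTransGen (N.ResidualStep f) N.s v) :
    ∃ g : E → ℝ, (∀ e, 0 < g e → f e < N.u e) ∧ (∀ e, g e < 0 → 0 < f e) ∧
      ∀ x, N.excess g x = (if N.s = x then 1 else 0) - (if v = x then 1 else 0) := by
  classical
  induction hv with
  | refl => exact ⟨fun _ => 0, by simp, by simp, fun x => by simp [excess]⟩
  | @tail v w _ hstep ih =>
    obtain ⟨g, hg1, hg2, hg3⟩ := ih
    rcases hstep with ⟨e, rfl, rfl, he⟩ | ⟨e, rfl, rfl, he⟩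
    · refine ⟨fun e' => g e' + if e' = e then 1 else 0, fun e' h => ?_, fun e' h => ?_,
        fun x => ?_⟩
      · by_cases h' : e' = e
        · exact h' ▸ he
        · exact hg1 e' (by simpa [h'] using h)
      · refine hg2 e' ?_
        by_cases h' : e' = e <;> simp [h'] at h ⊢ <;> linarith
      · have h := hg3 x
        rw [excess_eq_sum] at h ⊢
        simp only [add_mul, Finset.sum_add_distrib, h]
        simp
    · refine ⟨fun e' => g e' - if e' = e then 1 else 0, fun e' h => ?_, fun e' h => ?_,
        fun x => ?_⟩
      · refine hg1 e' ?_
        by_cases h' : e' = e <;> simp [h'] at h ⊢ <;> linarith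
      · by_cases h' : e' = e
        · exact h' ▸ he
        · exact hg2 e' (by simpa [h'] using h)
      · have h := hg3 x
        rw [excess_eq_sum] at h ⊢
        simp only [sub_mul, Finset.sum_sub_distrib, h]
        simp

theorem exists_pos_isFlow_add_smul {f g : E → ℝ} (hf : N.IsFlow f)
    (hg1 : ∀ e, 0 < g e → f e < N.u e) (hg2 : ∀ e, g e < 0 → 0 < f e)
    (hg3 : ∀ x, N.excess g x = (if N.s = x then 1 else 0) - (if N.t = x then 1 else 0)) :
    ∃ ε : ℝ, 0 < ε ∧ N.IsFlow (fun e => f e + ε * g e) ∧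
      N.excess (fun e => f e + ε * g e) N.s = N.excess f N.s + ε := by
  have hex : ∀ (ε : ℝ) x,
      N.excess (fun e => f e + ε * g e) x = N.excess f x + ε * N.excess g x := by
    intro ε x
    simp only [excess, Finset.sum_add_distrib, ← Finset.mul_sum]
    ring
  have hsmall : ∀ e, ∀ᶠ ε : ℝ in nhdsWithin 0 (Set.Ioi 0),
      0 ≤ f e + ε * g e ∧ f e + ε * g e ≤ N.u e := by
    intro e
    have hcont : Filter.Tendsto (fun ε : ℝ => f e + ε * g e) (nhdsWithin 0 (Set.Ioi 0))
        (nhds (f e)) := by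
      have : Continuous fun ε : ℝ => f e + ε * g e := by fun_prop
      simpa using (this.tendsto 0).mono_left nhdsWithin_le_nhds
    have h0 := hf.nonneg e
    have h1 := hf.le_capacity e
    refine Filter.Eventually.and ?_ ?_
    · rcases lt_or_ge (g e) 0 with h | h
      · exact (hcont.eventually (lt_mem_nhds (hg2 e h))).mono fun _ h => h.le
      · filter_upwards [self_mem_nhdsWithin] with ε hε
        have := mul_nonneg (le_of_lt hε) h
        linarith
    · rcases lt_or_ge 0 (g e) with h | h
      · exact (hcont.eventually (gt_mem_nhds (hg1 e h))).mono fun _ h => h.le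
      · filter_upwards [self_mem_nhdsWithin] with ε hε
        have := mul_nonpos_of_nonneg_of_nonpos (le_of_lt hε) h
        linarith
  obtain ⟨ε, hε, hpos⟩ :=
    ((Filter.eventually_all.2 hsmall).and (self_mem_nhdsWithin : Set.Ioi (0 : ℝ) ∈ _)).exists
  have hval : N.excess (fun e => f e + ε * g e) N.s = N.excess f N.s + ε := by
    rw [hex, hg3]
    simp [N.s_ne_t.symm]
  refine ⟨ε, hpos, ⟨fun e => (hε e).1, fun e => (hε e).2, fun v hvs hvt => ?_, ?_⟩, hval⟩
  · rw [hex, hg3, hf.conservation v hvs hvt]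
    simp [hvs.symm, hvt.symm]
  · rw [hval]
    exact add_nonneg hf.source_nonneg (le_of_lt hpos)

/-- The nontrivial half of the max-flow min-cut theorem: the vertices reachable from the source in
the residual network of a maximum flow form a cut that the flow saturates. -/
theorem exists_cut_le_maxFlow [Fintype V] :
    ∃ S : Finset V, N.s ∈ S ∧ N.t ∉ S ∧ ∑ e ∈ N.cutArcs S, (N.u e : ℝ) ≤ N.maxFlow := by
  classical
  obtain ⟨f, hf, hmax⟩ := N.exists_isFlow_excess_eq_maxFlow
  set S : Finset V := Finset.univ.filter (Relation.ReflTransGen (N.ResidualStep f) N.s) with hS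
  have hmem : ∀ v, v ∈ S ↔ Relation.ReflTransGen (N.ResidualStep f) N.s v := by simp [hS]
  have hs : N.s ∈ S := (hmem _).2 .refl
  have ht : N.t ∉ S := by
    intro h
    obtain ⟨g, hg1, hg2, hg3⟩ := N.exists_direction_of_reachable ((hmem _).1 h)
    obtain ⟨ε, hε, hflow, hval⟩ := N.exists_pos_isFlow_add_smul hf hg1 hg2 hg3
    have := hflow.excess_source_le_maxFlow
    linarith
  refine ⟨S, hs, ht, ?_⟩
  rw [← hmax, hf.excess_source_eq hs ht, cutArcs, Finset.sum_filter]
  refine Finset.sum_le_sum fun e _ => ?_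
  have hout : N.tail e ∈ S → N.head e ∉ S → (N.u e : ℝ) ≤ f e := fun h1 h2 => by
    by_contra! h
    exact h2 ((hmem _).2 (((hmem _).1 h1).tail (.inl ⟨e, rfl, rfl, h⟩)))
  have hin : N.head e ∈ S → N.tail e ∉ S → f e ≤ 0 := fun h1 h2 => by
    by_contra! h
    exact h2 ((hmem _).2 (((hmem _).1 h1).tail (.inr ⟨e, rfl, rfl, h⟩)))
  by_cases ha : N.tail e ∈ S <;> by_cases hb : N.head e ∈ S <;> simp [ha, hb]
  · exact hout ha hb
  · exact hin hb ha

end Cuts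

end FlowNetwork

/-! ### The arcs of the modified dual as crossings of darts -/

namespace ModArc

variable {E : Type*}

/-- The arc of the modified dual that is drawn along `a` in the opposite direction. -/
def rev : ModArc E → ModArc E
  | dual e => dualRev e
  | dualRev e => dual e
  | enter d => leave d
  | leave d => enter d

@[simp] theorem rev_rev (a : ModArc E) : a.rev.rev = a := by cases a <;> rfl

/-- The arcs of the modified dual, grouped by kind. -/
def equivSum (E : Type*) : ModArc E ≃ (E ⊕ E) ⊕ (FlowNetwork.Dart E ⊕ FlowNetwork.Dart E) where
  toFun
    | dual e => .inl (.inl e)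
    | dualRev e => .inl (.inr e)
    | enter d => .inr (.inl d)
    | leave d => .inr (.inr d)
  invFun
    | .inl (.inl e) => dual e
    | .inl (.inr e) => dualRev e
    | .inr (.inl d) => enter d
    | .inr (.inr d) => leave d
  left_inv a := by cases a <;> rfl
  right_inv x := by rcases x with (_ | _) | (_ | _) <;> rfl

noncomputable instance [Fintype E] : Fintype (ModArc E) := Fintype.ofEquiv _ (equivSum E).symm

theorem sum_eq [Fintype E] (F : ModArc E → ℝ) :
    ∑ a, F a = (∑ e, F (dual e) + ∑ e, F (dualRev e)) + (∑ d, F (enter d) + ∑ d, F (leave d)) := by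
  rw [← (equivSum E).symm.sum_comp]
  simp only [Fintype.sum_sum_type]
  rfl

/-- One arc out of each pair of opposite arcs of the modified dual. -/
def ofLink : E ⊕ FlowNetwork.Dart E → ModArc E
  | .inl e => dual e
  | .inr d => enter d

theorem forall_of_ofLink {p : ModArc E → Prop} (h : ∀ l, p (ofLink l))
    (hrev : ∀ a, p a → p a.rev) (a : ModArc E) : p a := by
  cases a with
  | dual e => exact h (.inl e)
  | dualRev e => exact hrev _ (h (.inl e))
  | enter d => exact h (.inr d)
  | leave d => exact hrev _ (h (.inr d))

theorem sum_eq_sum_ofLink [Fintype E] (F : ModArc E → ℝ) :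
    ∑ a, F a = ∑ l, (F (ofLink l) + F (ofLink l).rev) := by
  rw [sum_eq, Fintype.sum_sum_type, Finset.sum_add_distrib, Finset.sum_add_distrib]
  rfl

open scoped Classical in
/-- The arc set `C` as a chain in which opposite arcs cancel. -/
noncomputable def chain (C : Finset (ModArc E)) (a : ModArc E) : ℝ :=
  (if a ∈ C then 1 else 0) - (if a.rev ∈ C then 1 else 0)

theorem chain_rev (C : Finset (ModArc E)) (a : ModArc E) : chain C a.rev = -chain C a := by
  unfold chain
  rw [rev_rev, neg_sub]

end ModArc

namespace FlowNetwork

variable {V E : Type*} {N : FlowNetwork V E}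

/-- Since `s ≠ t`, a connected network has no isolated vertex. -/
theorem Connected.exists_dart (hconn : N.Connected) (v : V) : ∃ d, N.vert d = v := by
  have key : ∀ a b, Relation.EqvGen (fun a b => ∃ e, N.tail e = a ∧ N.head e = b) a b →
      a = b ∨ ((∃ d, N.vert d = a) ∧ ∃ d, N.vert d = b) := by
    intro a b h
    induction h with
    | rel a b h =>
      obtain ⟨e, rfl, rfl⟩ := h
      exact .inr ⟨⟨(e, false), rfl⟩, ⟨(e, true), rfl⟩⟩
    | refl a => exact .inl rfl
    | symm a b _ ih => exact ih.imp Eq.symm And.symm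
    | trans a b c _ _ ih1 ih2 =>
      rcases ih1 with rfl | h1
      · exact ih2
      · rcases ih2 with rfl | h2
        · exact .inr h1
        · exact .inr ⟨h1.1, h2.2⟩
  rcases key v N.s (hconn _ _) with h | h
  · rcases key v N.t (hconn _ _) with h' | h'
    · exact absurd (h.symm.trans h') N.s_ne_t
    · exact h'.1
  · exact h.1

end FlowNetwork

namespace FlowNetwork.PlanarEmbedding

open ModArc

variable {V E : Type*} {N : FlowNetwork V E} (M : N.PlanarEmbedding)

/-- The dart immediately to the left of an arc of the modified dual. The dart to its right is
`M.leftDart a.rev`. -/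
def leftDart : ModArc E → Dart E
  | .dual e => (e, false)
  | .dualRev e => (e, true)
  | .enter d => d
  | .leave d => M.rot d

/-- The difference of a function on darts between the left and the right side of an arc. -/
def jump (χ : Dart E → ℝ) (a : ModArc E) : ℝ := χ (M.leftDart a) - χ (M.leftDart a.rev)

theorem jump_rev (χ : Dart E → ℝ) (a : ModArc E) : M.jump χ a.rev = -M.jump χ a := by
  simp [jump]

theorem arcHead_rev (a : ModArc E) : M.arcHead a.rev = M.arcTail a := by cases a <;> rfl

theorem arcTail_rev (a : ModArc E) : M.arcTail a.rev = M.arcHead a := by cases a <;> rfl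

theorem vert_rot (d : Dart E) : N.vert (M.rot d) = N.vert d :=
  ((M.sameCycle_iff _ _).1 ⟨1, rfl⟩).symm

theorem leftFace_facePerm (d : Dart E) : M.leftFace (facePerm M.rot d) = M.leftFace d :=
  Quotient.sound (s := Equiv.Perm.SameCycle.setoid (facePerm M.rot))
    (Equiv.Perm.SameCycle.symm ⟨1, rfl⟩)

theorem rot_facePerm (d : Dart E) : M.rot (facePerm M.rot d) = opp d := by
  simp [facePerm]

/-- Summation by parts: the jumps of a function on darts form a circulation in the modified dual. -/
theorem sum_jump_mul_arcHead [Fintype E] (χ : Dart E → ℝ) (lam : M.Face ⊕ V → ℝ) :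
    ∑ a, M.jump χ a * lam (M.arcHead a) = 0 := by
  have hE : ∑ e, M.jump χ (.dual e) * lam (M.arcHead (.dual e)) +
      ∑ e, M.jump χ (.dualRev e) * lam (M.arcHead (.dualRev e)) =
      ∑ d, (χ d - χ (opp d)) * lam (.inl (M.leftFace d)) := by
    rw [Fintype.sum_prod_type, ← Finset.sum_add_distrib]
    refine Finset.sum_congr rfl fun e _ => ?_
    rw [Fintype.sum_bool, add_comm]
    rfl
  have hC : ∑ d, M.jump χ (.enter d) * lam (M.arcHead (.enter d)) =
      ∑ d, χ d * lam (.inr (N.vert d)) - ∑ d, χ (M.rot d) * lam (.inr (N.vert (M.rot d))) := by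
    rw [← Finset.sum_sub_distrib]
    refine Finset.sum_congr rfl fun d _ => ?_
    rw [vert_rot, ← sub_mul]
    rfl
  have hL : ∑ d, M.jump χ (.leave d) * lam (M.arcHead (.leave d)) =
      ∑ d, χ (M.rot d) * lam (.inl (M.leftFace d)) - ∑ d, χ d * lam (.inl (M.leftFace d)) := by
    rw [← Finset.sum_sub_distrib]
    refine Finset.sum_congr rfl fun d _ => ?_
    rw [← sub_mul]
    rfl
  have hV : ∑ d, χ (M.rot d) * lam (.inr (N.vert (M.rot d))) = ∑ d, χ d * lam (.inr (N.vert d)) :=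
    Equiv.sum_comp M.rot fun d => χ d * lam (.inr (N.vert d))
  have hF : ∑ d, χ (opp d) * lam (.inl (M.leftFace d)) =
      ∑ d, χ (M.rot d) * lam (.inl (M.leftFace d)) := by
    rw [← Equiv.sum_comp (facePerm M.rot) fun d => χ (M.rot d) * lam (.inl (M.leftFace d))]
    simp only [rot_facePerm, leftFace_facePerm]
  rw [ModArc.sum_eq, hE, hC, hL, hV, ← hF]
  simp only [sub_mul, Finset.sum_sub_distrib]
  ring

theorem sum_jump_mul_arcHead_sub_arcTail [Fintype E] (χ : Dart E → ℝ) (lam : M.Face ⊕ V → ℝ) :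
    ∑ l, M.jump χ (ofLink l) * (lam (M.arcHead (ofLink l)) - lam (M.arcTail (ofLink l))) = 0 := by
  rw [← M.sum_jump_mul_arcHead χ lam, sum_eq_sum_ofLink]
  refine Finset.sum_congr rfl fun l _ => ?_
  rw [jump_rev, arcHead_rev]
  ring

/-- The darts form one component if crossing arcs of the modified dual is allowed. -/
theorem eq_of_jump_eq_zero (hconn : N.Connected) {χ : Dart E → ℝ}
    (h : ∀ a, M.jump χ a = 0) (d d' : Dart E) : χ d = χ d' := by
  have hrot : ∀ d, χ (M.rot d) = χ d := fun d => sub_eq_zero.1 (h (.leave d))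
  have hopp : ∀ e, χ (e, false) = χ (e, true) := fun e => sub_eq_zero.1 (h (.dual e))
  have hpow : ∀ (n : ℕ) d, χ ((M.rot ^ n) d) = χ d := by
    intro n
    induction n with
    | zero => simp
    | succ n ih => intro d; rw [pow_succ', Equiv.Perm.mul_apply, hrot, ih]
  have hvert : ∀ d d', N.vert d = N.vert d' → χ d = χ d' := by
    intro d d' hd
    obtain ⟨n, rfl⟩ := (M.sameCycle_iff d d').2 hd
    obtain ⟨n, rfl | rfl⟩ := n.eq_nat_or_neg
    · simp [hpow]
    · have := hpow n ((M.rot ^ (-(n : ℤ))) d)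
      simpa using this
  have key : ∀ v w, Relation.EqvGen (fun a b => ∃ e, N.tail e = a ∧ N.head e = b) v w →
      ∀ d d', N.vert d = v → N.vert d' = w → χ d = χ d' := by
    intro v w hvw
    induction hvw with
    | rel v w h =>
      obtain ⟨e, rfl, rfl⟩ := h
      intro d d' hd hd'
      rw [hvert d (e, false) hd, hvert d' (e, true) hd', hopp]
    | refl v => exact fun d d' hd hd' => hvert d d' (hd.trans hd'.symm)
    | symm v w _ ih => exact fun d d' hd hd' => (ih d' d hd' hd).symm
    | trans u v w _ _ ih1 ih2 =>
      intro d d' hd hd'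
      obtain ⟨d₀, hd₀⟩ := hconn.exists_dart v
      exact (ih1 d d₀ hd hd₀).trans (ih2 d₀ d' hd₀ hd')
  exact key _ _ (hconn (N.vert d) (N.vert d')) d d' rfl rfl

/-- The modified dual is connected. -/
theorem eq_of_arcHead_eq_arcTail (hconn : N.Connected) {lam : M.Face ⊕ V → ℝ}
    (h : ∀ l, lam (M.arcHead (ofLink l)) = lam (M.arcTail (ofLink l))) (x y : M.Face ⊕ V) :
    lam x = lam y := by
  have hcorner : ∀ d, lam (.inr (N.vert d)) = lam (.inl (M.leftFace d)) := fun d => h (.inr d)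
  have hedge : ∀ e, lam (.inl (M.leftFace (e, false))) = lam (.inl (M.leftFace (e, true))) :=
    fun e => h (.inl e)
  have hV : ∀ v w : V, lam (.inr v) = lam (.inr w) := by
    intro v w
    have := hconn v w
    induction this with
    | rel v w h =>
      obtain ⟨e, rfl, rfl⟩ := h
      exact (hcorner (e, false)).trans ((hedge e).trans (hcorner (e, true)).symm)
    | refl v => rfl
    | symm v w _ ih => exact ih.symm
    | trans u v w _ _ ih1 ih2 => exact ih1.trans ih2
  have hs : ∀ x, lam x = lam (.inr N.s) := by
    rintro (f | v)
    · obtain ⟨d, rfl⟩ := Quotient.exists_rep f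
      exact (hcorner d).symm.trans (hV _ _)
    · exact hV _ _
  rw [hs x, hs y]

/-! ### Circulations of the modified dual have potentials -/

/-- The jumps of a function on darts, across one arc out of each pair of opposite arcs. -/
noncomputable def jumpMap : (Dart E → ℝ) →ₗ[ℝ] EuclideanSpace ℝ (E ⊕ Dart E) :=
  (WithLp.linearEquiv 2 ℝ (E ⊕ Dart E → ℝ)).symm.toLinearMap ∘ₗ
    { toFun := fun χ l => M.jump χ (ofLink l)
      map_add' := fun χ ψ => by ext l; simp [jump]; ring
      map_smul' := fun r χ => by ext l; simp [jump]; ring }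

/-- The gradient of a function on the vertices of the modified dual, along one arc out of each pair
of opposite arcs. -/
noncomputable def gradMap : (M.Face ⊕ V → ℝ) →ₗ[ℝ] EuclideanSpace ℝ (E ⊕ Dart E) :=
  (WithLp.linearEquiv 2 ℝ (E ⊕ Dart E → ℝ)).symm.toLinearMap ∘ₗ
    { toFun := fun lam l => lam (M.arcHead (ofLink l)) - lam (M.arcTail (ofLink l))
      map_add' := fun lam mu => by ext l; simp; ring
      map_smul' := fun r lam => by ext l; simp; ring }

theorem jumpMap_apply (χ : Dart E → ℝ) (l : E ⊕ Dart E) :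
    M.jumpMap χ l = M.jump χ (ofLink l) := rfl

theorem gradMap_apply (lam : M.Face ⊕ V → ℝ) (l : E ⊕ Dart E) :
    M.gradMap lam l = lam (M.arcHead (ofLink l)) - lam (M.arcTail (ofLink l)) := rfl

theorem jump_eq_zero_of_ofLink {χ : Dart E → ℝ} (h : ∀ l, M.jump χ (ofLink l) = 0)
    (a : ModArc E) : M.jump χ a = 0 :=
  forall_of_ofLink (p := fun a => M.jump χ a = 0) h
    (fun a ha => by rw [jump_rev, ha, neg_zero]) a

theorem finrank_le_one_of_constant {ι : Type*} (W : Submodule ℝ (ι → ℝ))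
    (hW : ∀ w ∈ W, ∀ i j, w i = w j) : Module.finrank ℝ W ≤ 1 := by
  have hle : W ≤ Submodule.span ℝ {fun _ => (1 : ℝ)} := by
    intro w hw
    rw [Submodule.mem_span_singleton]
    rcases isEmpty_or_nonempty ι with hι | ⟨⟨i⟩⟩
    · exact ⟨0, Subsingleton.elim _ _⟩
    · exact ⟨w i, funext fun j => by simp [hW w hw j i]⟩
  exact (Submodule.finrank_mono hle).trans ((finrank_span_le_card _).trans (by simp))

/-- On a sphere every circulation consists of the jumps of a function on darts. By summation by
parts, jumps are orthogonal to gradients; Euler's formula says that the dimensions of the two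
spaces add up to the number of links. -/
theorem exists_potential [Fintype V] [Fintype E] (hconn : N.Connected) (z : E ⊕ Dart E → ℝ)
    (hz : ∀ lam : M.Face ⊕ V → ℝ,
      ∑ l, z l * (lam (M.arcHead (ofLink l)) - lam (M.arcTail (ofLink l))) = 0) :
    ∃ χ : Dart E → ℝ, ∀ l, M.jump χ (ofLink l) = z l := by
  classical
  have : Finite M.Face := Quotient.finite _
  have : Fintype M.Face := Fintype.ofFinite _
  have hinner : ∀ x y : EuclideanSpace ℝ (E ⊕ Dart E), inner ℝ x y = ∑ l, x l * y l := by
    intro x y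
    simp [PiLp.inner_apply, mul_comm]
  have horth : LinearMap.range M.jumpMap ≤ (LinearMap.range M.gradMap)ᗮ := by
    rintro _ ⟨χ, rfl⟩
    rw [Submodule.mem_orthogonal']
    rintro _ ⟨lam, rfl⟩
    rw [hinner]
    exact M.sum_jump_mul_arcHead_sub_arcTail χ lam
  have hjump := M.jumpMap.finrank_range_add_finrank_ker
  have hgrad := M.gradMap.finrank_range_add_finrank_ker
  have hsum := (LinearMap.range M.gradMap).finrank_add_finrank_orthogonal
  have hker1 : Module.finrank ℝ (LinearMap.ker M.jumpMap) ≤ 1 := by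
    refine finrank_le_one_of_constant _ fun χ hχ => M.eq_of_jump_eq_zero hconn ?_
    refine M.jump_eq_zero_of_ofLink fun l => ?_
    rw [← jumpMap_apply, LinearMap.mem_ker.1 hχ]
    rfl
  have hker2 : Module.finrank ℝ (LinearMap.ker M.gradMap) ≤ 1 := by
    refine finrank_le_one_of_constant _ fun lam hlam => M.eq_of_arcHead_eq_arcTail hconn ?_
    intro l
    rw [← sub_eq_zero, ← gradMap_apply, LinearMap.mem_ker.1 hlam]
    rfl
  have heuler := M.euler
  rw [Nat.card_eq_fintype_card, Nat.card_eq_fintype_card (α := E),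
    show Nat.card (Quotient (Equiv.Perm.SameCycle.setoid (facePerm M.rot))) = Fintype.card M.Face
      from Nat.card_eq_fintype_card (α := M.Face)] at heuler
  rw [Module.finrank_fintype_fun_eq_card, Fintype.card_prod, Fintype.card_bool] at hjump
  rw [Module.finrank_fintype_fun_eq_card, Fintype.card_sum] at hgrad
  rw [finrank_euclideanSpace, Fintype.card_sum, Fintype.card_prod, Fintype.card_bool] at hsum
  have heq := Submodule.eq_of_le_of_finrank_le horth (by omega)
  have hmem : WithLp.toLp 2 z ∈ (LinearMap.range M.gradMap)ᗮ := by
    rw [Submodule.mem_orthogonal']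
    rintro _ ⟨lam, rfl⟩
    rw [hinner]
    exact hz lam
  rw [← heq] at hmem
  obtain ⟨χ, hχ⟩ := hmem
  exact ⟨χ, fun l => by rw [← jumpMap_apply, hχ]⟩

/-- The arc set `A` is the oriented boundary of the function `χ` on darts: `χ` increases by one
from right to left of each arc of `A`, and changes nowhere else. -/
def IsPotential (A : Finset (ModArc E)) (χ : Dart E → ℝ) : Prop :=
  ∀ a, M.jump χ a = chain A a

variable {M}

/-- The discrete Jordan curve theorem: a circuit is the oriented boundary of a function on darts. -/
theorem IsCircuit.exists_potential [Fintype V] [Fintype E] (hconn : N.Connected)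
    {C : Finset (ModArc E)} (hC : M.IsCircuit C) : ∃ χ, M.IsPotential C χ := by
  classical
  obtain ⟨k, a, hinj, hnext, hrange⟩ := hC
  have hainj : Function.Injective a := fun i j h => hinj (congrArg M.arcTail h)
  have hCimg : C = Finset.univ.image a := by
    apply Finset.coe_injective
    simp [hrange]
  obtain ⟨χ, hχ⟩ := M.exists_potential hconn (fun l => chain C (ofLink l)) fun lam => by
    have h1 : ∑ l, chain C (ofLink l) *
        (lam (M.arcHead (ofLink l)) - lam (M.arcTail (ofLink l))) =
        ∑ b, (if b ∈ C then 1 else 0) * (lam (M.arcHead b) - lam (M.arcTail b)) := by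
      rw [sum_eq_sum_ofLink]
      refine Finset.sum_congr rfl fun l _ => ?_
      rw [arcHead_rev, arcTail_rev, chain]
      ring
    have h2 : ∑ i, lam (M.arcHead (a i)) = ∑ i, lam (M.arcTail (a i)) := by
      simp only [hnext]
      exact Equiv.sum_comp (Equiv.addRight (1 : Fin (k + 1))) fun i => lam (M.arcTail (a i))
    rw [h1]
    simp only [ite_mul, one_mul, zero_mul, Finset.sum_ite_mem, Finset.univ_inter]
    rw [hCimg, Finset.sum_image fun i _ j _ h => hainj h, Finset.sum_sub_distrib, h2, sub_self]
  refine ⟨χ, forall_of_ofLink hχ fun a ha => ?_⟩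
  rw [jump_rev, chain_rev, ha]

/-- A function on darts that changes only across the arcs of a circuit has the same jump across
all of them, since the jumps form a circulation. -/
theorem IsCircuit.jump_eq [Fintype E] {C : Finset (ModArc E)} (hC : M.IsCircuit C)
    {χ : Dart E → ℝ} (hχ : ∀ a, a ∉ C → a.rev ∉ C → M.jump χ a = 0) {a b : ModArc E}
    (ha : a ∈ C) (hb : b ∈ C) : M.jump χ a = M.jump χ b := by
  classical
  obtain ⟨k, c, hinj, hnext, hrange⟩ := hC
  have hmem : ∀ x, x ∈ C ↔ ∃ i, c i = x := fun x => by
    rw [← Finset.mem_coe, hrange, Set.mem_range]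
  have hstep : ∀ i, M.jump χ (c (i + 1)) = M.jump χ (c i) := by
    intro i
    have hsum := M.sum_jump_mul_arcHead χ fun x => if x = M.arcHead (c i) then 1 else 0
    -- The only arcs of `C` and of its reverse that end where `c i` ends.
    have hzero : ∀ x, x ≠ c i → x ≠ (c (i + 1)).rev →
        M.jump χ x * (if M.arcHead x = M.arcHead (c i) then 1 else 0) = 0 := by
      intro x hx1 hx2
      by_cases hx : M.arcHead x = M.arcHead (c i)
      · rw [hχ x, zero_mul]
        · intro hxC
          obtain ⟨j, rfl⟩ := (hmem x).1 hxC
          rw [hnext, hnext] at hx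
          exact hx1 (by rw [add_right_cancel (hinj hx)])
        · intro hxC
          obtain ⟨j, hj⟩ := (hmem _).1 hxC
          have hx' : x = (c j).rev := by rw [hj, rev_rev]
          rw [hx', arcHead_rev, hnext] at hx
          exact hx2 (by rw [hx', hinj hx])
      · rw [if_neg hx, mul_zero]
    have hhead : M.arcHead (c (i + 1)).rev = M.arcHead (c i) := by rw [arcHead_rev, hnext]
    by_cases heq : (c (i + 1)).rev = c i
    · rw [Finset.sum_eq_single (c i) (fun x _ hx => hzero x hx (heq ▸ hx)) (by simp)] at hsum
      have h0 : M.jump χ (c i) = 0 := by simpa using hsum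
      rw [← rev_rev (c (i + 1)), jump_rev, heq, h0, neg_zero]
    · rw [Fintype.sum_eq_add (c i) (c (i + 1)).rev (Ne.symm heq)
        fun x hx => hzero x hx.1 hx.2, hhead, jump_rev] at hsum
      simp at hsum
      linarith
  have hall : ∀ i, M.jump χ (c i) = M.jump χ (c 0) := by
    intro i
    induction i using Fin.induction with
    | zero => rfl
    | succ i ih =>
      have := hstep i.castSucc
      rw [← Fin.coeSucc_eq_succ, this, ih]
  obtain ⟨i, rfl⟩ := (hmem a).1 ha
  obtain ⟨j, rfl⟩ := (hmem b).1 hb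
  rw [hall i, hall j]

/-! ### Decomposition into circuits -/

open scoped Classical in
/-- The indicator function of a set of darts. -/
noncomputable def ind (K : Dart E → Prop) (d : Dart E) : ℝ := if K d then 1 else 0

theorem ind_of_pos {K : Dart E → Prop} {d : Dart E} (h : K d) : ind K d = 1 := if_pos h

theorem ind_of_neg {K : Dart E → Prop} {d : Dart E} (h : ¬ K d) : ind K d = 0 := if_neg h

open scoped Classical in
/-- The arcs of the modified dual that have `K` on their left and its complement on their right. -/
noncomputable def boundary [Fintype E] (M : N.PlanarEmbedding) (K : Dart E → Prop) :
    Finset (ModArc E) :=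
  Finset.univ.filter fun a => K (M.leftDart a) ∧ ¬ K (M.leftDart a.rev)

theorem mem_boundary [Fintype E] {K : Dart E → Prop} {a : ModArc E} :
    a ∈ M.boundary K ↔ K (M.leftDart a) ∧ ¬ K (M.leftDart a.rev) := by
  simp [boundary]

theorem isPotential_boundary [Fintype E] (K : Dart E → Prop) :
    M.IsPotential (M.boundary K) (ind K) := by
  intro a
  unfold jump chain ind
  by_cases h1 : K (M.leftDart a) <;> by_cases h2 : K (M.leftDart a.rev) <;>
    simp [mem_boundary, h1, h2]

theorem IsCircuit.exists_prev {C : Finset (ModArc E)} (hC : M.IsCircuit C) {b : ModArc E}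
    (hb : b ∈ C) : ∃ a ∈ C, M.arcHead a = M.arcTail b := by
  obtain ⟨k, a, -, hnext, hrange⟩ := hC
  rw [← Finset.mem_coe, hrange] at hb
  obtain ⟨i, rfl⟩ := hb
  exact ⟨a (i - 1), by rw [← Finset.mem_coe, hrange]; exact ⟨_, rfl⟩,
    by rw [hnext, sub_add_cancel]⟩

theorem IsCircuit.eq_of_arcHead_eq {C : Finset (ModArc E)} (hC : M.IsCircuit C) {a b : ModArc E}
    (ha : a ∈ C) (hb : b ∈ C) (h : M.arcHead a = M.arcHead b) : a = b := by
  obtain ⟨k, c, hinj, hnext, hrange⟩ := hC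
  rw [← Finset.mem_coe, hrange] at ha hb
  obtain ⟨i, rfl⟩ := ha
  obtain ⟨j, rfl⟩ := hb
  rw [hnext, hnext] at h
  rw [add_right_cancel (hinj h)]

/-- A potential makes the arc set balanced at every vertex of the modified dual. -/
theorem IsPotential.exists_next [Fintype E] {A : Finset (ModArc E)} {χ : Dart E → ℝ}
    (hA : M.IsPotential A χ) {a : ModArc E} (ha : a ∈ A) :
    ∃ b ∈ A, M.arcTail b = M.arcHead a := by
  classical
  by_contra! hno
  have hsum := M.sum_jump_mul_arcHead χ fun x => if x = M.arcHead a then 1 else 0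
  have hterm : ∀ b, M.jump χ b * (if M.arcHead b = M.arcHead a then 1 else 0) =
      if b ∈ A ∧ M.arcHead b = M.arcHead a then 1 else 0 := by
    intro b
    by_cases hb : M.arcHead b = M.arcHead a
    · have : b.rev ∉ A := fun h => hno _ h (by rw [arcTail_rev, hb])
      rw [hA b, chain]
      simp [hb, this]
    · simp [hb]
  simp only [hterm] at hsum
  rw [Finset.sum_eq_zero_iff_of_nonneg fun b _ => by split_ifs <;> simp] at hsum
  simpa [ha] using hsum a (Finset.mem_univ a)

/-- Walking along a balanced arc set eventually closes up. -/
theorem IsPotential.exists_circuit_subset [Fintype V] [Fintype E] {A : Finset (ModArc E)}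
    {χ : Dart E → ℝ} (hA : M.IsPotential A χ) (hne : A.Nonempty) :
    ∃ C ⊆ A, M.IsCircuit C := by
  classical
  -- A choice of one arc of `A` out of each vertex turns walking along `A` into iterating a map.
  set out : M.Face ⊕ V → ModArc E := fun x =>
    if h : ∃ a ∈ A, M.arcTail a = x then h.choose else hne.choose with hout
  have hout_mem : ∀ x, out x ∈ A := by
    intro x
    simp only [hout]
    split_ifs with h
    · exact h.choose_spec.1
    · exact hne.choose_spec
  have hout_tail : ∀ a ∈ A, M.arcTail (out (M.arcHead a)) = M.arcHead a := by
    intro a ha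
    have h := hA.exists_next ha
    simp only [hout, dif_pos h]
    exact h.choose_spec.2
  set f : M.Face ⊕ V → M.Face ⊕ V := fun x => M.arcHead (out x)
  have : Finite M.Face := Quotient.finite _
  obtain ⟨x, hx⟩ : ∃ x, x ∈ Function.periodicPts f := by
    obtain ⟨m, n, hmn, heq⟩ := Finite.exists_ne_map_eq_of_infinite
      fun n : ℕ => f^[n] (Sum.inr N.s)
    wlog hlt : m < n generalizing m n
    · exact this n m hmn.symm heq.symm (by omega)
    refine ⟨f^[m] (Sum.inr N.s), n - m, by omega, ?_⟩
    rw [Function.IsPeriodicPt, Function.IsFixedPt, ← Function.iterate_add_apply,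
      Nat.sub_add_cancel hlt.le]
    exact heq.symm
  have hpos := Function.minimalPeriod_pos_of_mem_periodicPts hx
  obtain ⟨k, hk⟩ : ∃ k, Function.minimalPeriod f x = k + 1 := ⟨_, (Nat.sub_add_cancel hpos).symm⟩
  have htail_iter : ∀ n, M.arcTail (out (f^[n] x)) = f^[n] x := by
    have hs : ∀ n, M.arcTail (out (f^[n + 1] x)) = f^[n + 1] x := by
      intro n
      rw [Function.iterate_succ_apply']
      exact hout_tail _ (hout_mem _)
    intro n
    cases n with
    | succ n => exact hs n
    | zero =>
      have hper : f^[k + 1] x = x := hk ▸ Function.iterate_minimalPeriod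
      have := hs k
      rwa [hper] at this
  refine ⟨Finset.univ.image fun i : Fin (k + 1) => out (f^[i] x), ?_, k,
    fun i : Fin (k + 1) => out (f^[i] x), ?_, ?_, by simp⟩
  · intro a ha
    obtain ⟨i, -, rfl⟩ := Finset.mem_image.1 ha
    exact hout_mem _
  · intro i j hij
    simp only [htail_iter] at hij
    exact Fin.ext (Function.iterate_injOn_Iio_minimalPeriod (hk.symm ▸ i.2 : (i : ℕ) < _)
      (hk.symm ▸ j.2 : (j : ℕ) < _) hij)
  · intro i
    have hmod : ∀ n, f^[n % (k + 1)] x = f^[n] x := fun n => by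
      rw [← hk, Function.iterate_mod_minimalPeriod_eq]
    rw [htail_iter, Fin.val_add, Fin.val_one', Nat.add_mod_mod, hmod, Function.iterate_succ_apply']

/-- If the potential of `A` is higher at `d` than at `d'`, then so is the potential of one of the
circuits into which `A` decomposes. -/
theorem IsPotential.exists_circuit_lt [Fintype V] [Fintype E] (hconn : N.Connected)
    {A : Finset (ModArc E)} {χ : Dart E → ℝ} (hA : M.IsPotential A χ) {d d' : Dart E}
    (hlt : χ d' < χ d) :
    ∃ C ⊆ A, M.IsCircuit C ∧ ∃ ψ, M.IsPotential C ψ ∧ ψ d' < ψ d := by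
  classical
  induction A using Finset.strongInduction generalizing χ with
  | H A ih =>
    have hne : A.Nonempty := by
      rw [Finset.nonempty_iff_ne_empty]
      rintro rfl
      refine hlt.ne (M.eq_of_jump_eq_zero hconn (fun a => ?_) d' d)
      rw [hA a]
      simp [chain]
    obtain ⟨C, hCA, hC⟩ := hA.exists_circuit_subset hne
    obtain ⟨ψ, hψ⟩ := hC.exists_potential hconn
    rcases lt_or_ge (ψ d') (ψ d) with h | h
    · exact ⟨C, hCA, hC, ψ, hψ, h⟩
    · have hCne : C.Nonempty := by
        obtain ⟨k, a, -, -, hrange⟩ := hC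
        exact ⟨a 0, by rw [← Finset.mem_coe, hrange]; exact ⟨0, rfl⟩⟩
      have hdiff : M.IsPotential (A \ C) (χ - ψ) := by
        intro a
        have h1 := hA a
        have h2 := hψ a
        have hind : ∀ b, (if b ∈ A \ C then (1 : ℝ) else 0) =
            (if b ∈ A then 1 else 0) - (if b ∈ C then 1 else 0) := by
          intro b
          by_cases hbC : b ∈ C
          · simp [hbC, hCA hbC]
          · simp [hbC]
        simp only [jump, chain, Pi.sub_apply, hind] at *
        linarith
      obtain ⟨C', hC'A, h'⟩ := ih (A \ C) (Finset.sdiff_ssubset hCA hCne) hdiff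
        (by simp only [Pi.sub_apply]; linarith)
      exact ⟨C', hC'A.trans Finset.sdiff_subset, h'⟩

/-! ### The sides of a circuit -/

theorem bordersLeft_iff {C : Finset (ModArc E)} {d : Dart E} :
    M.BordersLeft C d ↔ ∃ a ∈ C, M.leftDart a = d := by
  constructor
  · rcases d with ⟨e, b⟩
    rintro (⟨h, h'⟩ | ⟨h, h'⟩ | h | h)
    · exact ⟨_, h, by cases h'; rfl⟩
    · exact ⟨_, h, by cases h'; rfl⟩
    · exact ⟨_, h, rfl⟩
    · exact ⟨_, h, by simp [leftDart]⟩
  · rintro ⟨a, ha, rfl⟩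
    cases a with
    | dual e => exact .inl ⟨ha, rfl⟩
    | dualRev e => exact .inr (.inl ⟨ha, rfl⟩)
    | enter d => exact .inr (.inr (.inl ha))
    | leave d => exact .inr (.inr (.inr (by simpa [leftDart] using ha)))

theorem sameSide_leftDart {C : Finset (ModArc E)} {a : ModArc E} (ha : a ∉ C) (ha' : a.rev ∉ C) :
    M.SameSide C (M.leftDart a) (M.leftDart a.rev) := by
  cases a with
  | dual e => exact .rel _ _ (.inl ⟨rfl, ha, ha'⟩)
  | dualRev e => exact .rel _ _ (.inl ⟨rfl, ha', ha⟩)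
  | enter d => exact .rel _ _ (.inr ⟨rfl, ha, ha'⟩)
  | leave d => exact .symm _ _ (.rel _ _ (.inr ⟨rfl, ha', ha⟩))

theorem eq_of_sameSide {C : Finset (ModArc E)} {χ : Dart E → ℝ}
    (hχ : ∀ a, a ∉ C → a.rev ∉ C → M.jump χ a = 0) {d d' : Dart E} (h : M.SameSide C d d') :
    χ d = χ d' := by
  induction h with
  | rel d d' h =>
    rcases h with ⟨rfl, h1, h2⟩ | ⟨rfl, h1, h2⟩
    · rcases d with ⟨e, _ | _⟩
      · exact sub_eq_zero.1 (hχ (.dual e) h1 h2)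
      · exact sub_eq_zero.1 (hχ (.dualRev e) h2 h1)
    · exact sub_eq_zero.1 (hχ (.enter d) h1 h2)
  | refl d => rfl
  | symm d d' _ ih => exact ih.symm
  | trans d d' d'' _ _ ih1 ih2 => exact ih1.trans ih2

theorem sameSide_of_not_visits {C : Finset (ModArc E)} {d d' : Dart E}
    (h : ¬ N.Visits C (N.vert d)) (hd : N.vert d' = N.vert d) : M.SameSide C d d' := by
  have hrot : ∀ x, N.vert x = N.vert d → M.SameSide C x (M.rot x) := fun x hx =>
    .rel _ _ (.inr ⟨rfl, fun h' => h ⟨x, hx, .inl h'⟩, fun h' => h ⟨x, hx, .inr h'⟩⟩)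
  have hpow : ∀ (n : ℕ) x, N.vert x = N.vert d → M.SameSide C x ((M.rot ^ n) x) := by
    intro n
    induction n with
    | zero => exact fun x _ => .refl x
    | succ n ih =>
      intro x hx
      rw [pow_succ, Equiv.Perm.mul_apply]
      exact .trans _ _ _ (hrot x hx) (ih _ ((M.vert_rot x).trans hx))
  obtain ⟨n, hn⟩ := (M.sameCycle_iff d d').2 hd.symm
  obtain ⟨n, rfl | rfl⟩ := n.eq_nat_or_neg
  · rw [← hn]
    simpa using hpow n d rfl
  · have := hpow n d' hd
    have hback : (M.rot ^ n) d' = d := by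
      rw [← hn, ← Equiv.Perm.mul_apply, zpow_neg, zpow_natCast, mul_inv_cancel,
        Equiv.Perm.one_apply]
    rw [hback] at this
    exact .symm _ _ this

theorem jump_ind_sameSide (C : Finset (ModArc E)) (d : Dart E) (a : ModArc E) (ha : a ∉ C)
    (ha' : a.rev ∉ C) : M.jump (ind (M.SameSide C d)) a = 0 := by
  have h := sameSide_leftDart (M := M) ha ha'
  rw [jump, sub_eq_zero]
  by_cases h' : M.SameSide C d (M.leftDart a)
  · rw [ind_of_pos h', ind_of_pos (.trans _ _ _ h' h)]
  · have h'' : ¬ M.SameSide C d (M.leftDart a.rev) := fun h'' => h' (.trans _ _ _ h'' (.symm _ _ h))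
    rw [ind_of_neg h', ind_of_neg h'']

/-- A circuit whose potential is higher at `s` than at `t` separates `s` from `t`. If no arc of the
circuit had the component of `s` on its left, the indicator function of that component would have
jump `0` or `-1` along the whole circuit; added to the potential it would then give a
constant function in the latter case, and in the former case it would itself be constant. -/
theorem IsCircuit.isSTSeparatingCCW [Fintype E] (hconn : N.Connected) {C : Finset (ModArc E)}
    (hC : M.IsCircuit C) (hs : ¬ N.Visits C N.s) (ht : ¬ N.Visits C N.t) {ψ : Dart E → ℝ}
    (hψ : M.IsPotential C ψ) {d d' : Dart E} (hd : N.vert d = N.s) (hd' : N.vert d' = N.t)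
    (hlt : ψ d' < ψ d) : M.IsSTSeparatingCCW C := by
  have hψ0 : ∀ a, a ∉ C → a.rev ∉ C → M.jump ψ a = 0 := fun a ha ha' => by
    rw [hψ a]
    simp [chain, ha, ha']
  have hsep : M.Separates C N.s N.t := by
    refine ⟨hs, ht, fun x y hx hy hxy => hlt.ne ?_⟩
    have h1 := eq_of_sameSide hψ0 (sameSide_of_not_visits (by rwa [hd]) (hx.trans hd.symm))
    have h2 := eq_of_sameSide hψ0 (sameSide_of_not_visits (by rwa [hd']) (hy.trans hd'.symm))
    rw [h1, h2, eq_of_sameSide hψ0 hxy]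
  have hnot : ¬ M.SameSide C d d' := hsep.2.2 d d' hd hd'
  refine ⟨hC, ⟨hs, ?_⟩, hsep⟩
  by_contra hno
  set χ := ind (M.SameSide C d) with hχ
  have hχ0 : ∀ a, a ∉ C → a.rev ∉ C → M.jump χ a = 0 := jump_ind_sameSide C d
  have hχd : χ d = 1 := ind_of_pos (.refl d)
  have hχd' : χ d' = 0 := ind_of_neg hnot
  have hleft : ∀ a ∈ C, χ (M.leftDart a) = 0 := fun a ha => ind_of_neg fun h =>
    hno ⟨d, _, hd, bordersLeft_iff.2 ⟨a, ha, rfl⟩, h⟩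
  obtain ⟨a₀, ha₀⟩ : C.Nonempty := by
    obtain ⟨k, a, -, -, hrange⟩ := hC
    exact ⟨a 0, by rw [← Finset.mem_coe, hrange]; exact ⟨0, rfl⟩⟩
  by_cases hright : M.SameSide C d (M.leftDart a₀.rev)
  · have hj : ∀ a ∈ C, M.jump χ a = -1 := fun a ha => by
      rw [hC.jump_eq hχ0 ha ha₀, jump, hleft a₀ ha₀, hχ, ind_of_pos hright, zero_sub]
    have hconst : ∀ a, M.jump (ψ + χ) a = 0 := by
      intro a
      have hadd : M.jump (ψ + χ) a = M.jump ψ a + M.jump χ a := by simp [jump]; ring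
      rw [hadd, hψ a, chain]
      by_cases h1 : a ∈ C <;> by_cases h2 : a.rev ∈ C
      · have := hj _ h2
        rw [jump_rev, hj _ h1] at this
        norm_num at this
      · simp [h1, h2, hj a h1]
      · have := hj _ h2
        rw [jump_rev] at this
        simp [h1, h2]
        linarith
      · rw [hχ0 a h1 h2]
        simp [h1, h2]
    have := M.eq_of_jump_eq_zero hconn hconst d d'
    simp only [Pi.add_apply] at this
    linarith
  · have hj : ∀ a ∈ C, M.jump χ a = 0 := fun a ha => by
      rw [hC.jump_eq hχ0 ha ha₀, jump, hleft a₀ ha₀, hχ, ind_of_neg hright, sub_zero]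
    have := M.eq_of_jump_eq_zero hconn (χ := χ) (fun a => by
      by_cases h1 : a ∈ C
      · exact hj a h1
      · by_cases h2 : a.rev ∈ C
        · rw [← neg_eq_zero, ← jump_rev, hj _ h2]
        · exact hχ0 a h1 h2) d d'
    linarith

/-- Every arc of an `s`-`t` separating counterclockwise circuit has the component of `s` on its left
and not on its right. -/
theorem IsSTSeparatingCCW.sides [Fintype E] (hconn : N.Connected) {C : Finset (ModArc E)}
    (hC : M.IsSTSeparatingCCW C) {d : Dart E} (hd : N.vert d = N.s) {a : ModArc E} (ha : a ∈ C) :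
    M.SameSide C d (M.leftDart a) ∧ ¬ M.SameSide C d (M.leftDart a.rev) := by
  obtain ⟨hcirc, ⟨hs, d₁, d₂, hd₁, hd₂, h12⟩, -, -, hsep⟩ := hC
  obtain ⟨b, hb, rfl⟩ := bordersLeft_iff.1 hd₂
  have hdb : M.SameSide C d (M.leftDart b) :=
    .trans _ _ _ (sameSide_of_not_visits (by rwa [hd]) (hd₁.trans hd.symm)) h12
  obtain ⟨d', hd'⟩ := hconn.exists_dart N.t
  have hnot := hsep d d' hd hd'
  have hχ0 := jump_ind_sameSide (M := M) C d
  -- The jump along the circuit is not zero, as the indicator function is not constant.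
  have hb' : ¬ M.SameSide C d (M.leftDart b.rev) := by
    intro hb'
    have hb0 : M.jump (ind (M.SameSide C d)) b = 0 := by
      rw [jump, ind_of_pos hdb, ind_of_pos hb', sub_self]
    have := M.eq_of_jump_eq_zero hconn (fun x => by
      by_cases h1 : x ∈ C
      · rw [hcirc.jump_eq hχ0 h1 hb, hb0]
      · by_cases h2 : x.rev ∈ C
        · rw [← neg_eq_zero, ← jump_rev, hcirc.jump_eq hχ0 h2 hb, hb0]
        · exact hχ0 x h1 h2) d d'
    rw [ind_of_pos (.refl d), ind_of_neg hnot] at this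
    exact one_ne_zero this
  have hjump : M.jump (ind (M.SameSide C d)) a = 1 := by
    rw [hcirc.jump_eq hχ0 ha hb, jump, ind_of_pos hdb, ind_of_neg hb', sub_zero]
  have hle : ∀ x, ind (M.SameSide C d) x ≤ 1 := fun x => by
    unfold ind
    split_ifs <;> norm_num
  have hge : ∀ x, 0 ≤ ind (M.SameSide C d) x := fun x => by
    unfold ind
    split_ifs <;> norm_num
  rw [jump] at hjump
  constructor
  · by_contra h
    have := hge (M.leftDart a.rev)
    rw [ind_of_neg h] at hjump
    linarith
  · intro h
    have := hle (M.leftDart a)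
    rw [ind_of_pos h] at hjump
    linarith

end FlowNetwork.PlanarEmbedding

/-! ### Interdiction -/

/-- Comparison of sums along a relation that is injective on the terms that matter. -/
theorem sum_le_sum_of_rel {ι κ : Type*} {s : Finset ι} {t : Finset κ} {f : ι → ℕ∞} {g : κ → ℕ∞}
    (p : ι → κ → Prop) (h : ∀ a ∈ s, f a ≠ 0 → ∃ b ∈ t, p a b ∧ f a ≤ g b)
    (hinj : ∀ a ∈ s, ∀ a' ∈ s, ∀ b, p a b → p a' b → a = a') :
    ∑ a ∈ s, f a ≤ ∑ b ∈ t, g b := by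
  classical
  rcases isEmpty_or_nonempty κ with hκ | hκ
  · refine (Finset.sum_eq_zero fun a ha => ?_).trans_le zero_le
    by_contra hf
    obtain ⟨b, -⟩ := h a ha hf
    exact hκ.false b
  choose! i hi hp hle using h
  rw [← Finset.sum_filter_ne_zero]
  calc ∑ a ∈ s.filter (f · ≠ 0), f a
      ≤ ∑ a ∈ s.filter (f · ≠ 0), g (i a) := Finset.sum_le_sum fun a ha =>
        hle a (Finset.mem_filter.1 ha).1 (Finset.mem_filter.1 ha).2
    _ = ∑ b ∈ (s.filter (f · ≠ 0)).image i, g b := by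
        refine (Finset.sum_image fun a ha a' ha' haa => ?_).symm
        obtain ⟨ha, hf⟩ := Finset.mem_filter.1 ha
        obtain ⟨ha', hf'⟩ := Finset.mem_filter.1 ha'
        exact hinj a ha a' ha' _ (hp a ha hf) (haa ▸ hp a' ha' hf')
    _ ≤ ∑ b ∈ t, g b := by
        refine Finset.sum_le_sum_of_subset fun b hb => ?_
        obtain ⟨a, ha, rfl⟩ := Finset.mem_image.1 hb
        exact hi a (Finset.mem_filter.1 ha).1 (Finset.mem_filter.1 ha).2

namespace InterdictionNetwork

open FlowNetwork FlowNetwork.PlanarEmbedding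

variable {V E : Type*} (G : InterdictionNetwork V E)

/-- The arc `a` of the modified dual stands for the removal of `r`: a dual arc for that of the arc
it crosses, an arc into a vertex for that of the vertex. -/
inductive Removes : ModArc E → V ⊕ E → Prop
  | dual (e : E) : Removes (.dual e) (.inr e)
  | enter (d : Dart E) : Removes (.enter d) (.inl (G.vert d))

variable {G}

theorem Removes.modCost_eq {a : ModArc E} {r : V ⊕ E} (h : G.Removes a r) :
    G.modCost a = G.c r := by
  cases h <;> rfl

theorem Removes.right_unique {a : ModArc E} {r r' : V ⊕ E} (h : G.Removes a r)
    (h' : G.Removes a r') : r = r' := by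
  cases h <;> cases h' <;> rfl

theorem Removes.left_unique {M : G.PlanarEmbedding} {C : Finset (ModArc E)} (hC : M.IsCircuit C)
    {a a' : ModArc E} (ha : a ∈ C) (ha' : a' ∈ C) {r : V ⊕ E} (h : G.Removes a r)
    (h' : G.Removes a' r) : a = a' := by
  rcases r with v | e
  · refine hC.eq_of_arcHead_eq ha ha' ?_
    cases h with
    | enter d =>
      generalize hv : G.vert d = v at h'
      cases h'
      exact congrArg Sum.inr hv
  · cases h
    cases h'
    rfl

variable (G) in
open scoped Classical in
theorem exists_reducedLength_eq (B : ℕ) (U : Finset (ModArc E)) :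
    ∃ X ⊆ U, ∑ a ∈ X, G.modCost a ≤ (B : ℕ∞) ∧
      G.reducedLength B U = ∑ a ∈ U \ X, G.modLength a :=
  csInf_mem (s := {L : ℕ∞ | ∃ X ⊆ U, ∑ a ∈ X, G.modCost a ≤ (B : ℕ∞) ∧
    L = ∑ a ∈ U \ X, G.modLength a}) ⟨_, ∅, Finset.empty_subset _, by simp, rfl⟩

theorem natCast_toEReal (n : ℕ) : (((n : ℕ∞) : ℝ≥0∞) : EReal) = ((n : ℝ) : EReal) := by
  rw [ENat.toENNReal_coe]
  rfl

/-- The arcs of a minimum cut of `G ∖ R`, the arcs in `R` and the vertices in `R` carry the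
boundary of a set of darts that contains those at `s` and none at `t`. One of the circuits into
which this boundary decomposes separates `s` from `t`. -/
theorem exists_circuit_le_maxFlow [Fintype V] [DecidableEq V] [Fintype E] [DecidableEq E]
    (hconn : G.toFlowNetwork.Connected) (M : G.toFlowNetwork.PlanarEmbedding) {B : ℕ}
    {R : Finset (V ⊕ E)} (hR : G.IsInterdictionSet B R) :
    ∃ C : Finset (ModArc E), M.IsSTSeparatingCCW C ∧
      ((G.reducedLength B C : ℝ≥0∞) : EReal) ≤
        (((G.remove R hR.s_notMem hR.t_notMem).maxFlow : ℝ) : EReal) := by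
  classical
  obtain ⟨S, hsS, htS, hcut⟩ :=
    (G.remove R hR.s_notMem hR.t_notMem).exists_cut_le_maxFlow
  set inS : V → Prop := fun v => ∃ h : Sum.inl v ∉ R, ⟨v, h⟩ ∈ S
  -- A dart at a removed vertex lies on the same side as its other half, unless that belongs to a
  -- removed vertex as well.
  set K : Dart E → Prop := fun d =>
    inS (G.vert d) ∨ Sum.inl (G.vert d) ∈ R ∧ inS (G.vert (opp d)) with hK
  have hdual : ∀ e, ModArc.dual e ∈ M.boundary K → inS (G.tail e) ∧ ¬ inS (G.head e) ∧
      Sum.inl (G.head e) ∉ R := by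
    intro e he
    obtain ⟨h1, h2⟩ := mem_boundary.1 he
    replace h1 : inS (G.tail e) ∨ Sum.inl (G.tail e) ∈ R ∧ inS (G.head e) := h1
    replace h2 : ¬ (inS (G.head e) ∨ Sum.inl (G.head e) ∈ R ∧ inS (G.tail e)) := h2
    tauto
  have hrot : ∀ d, ¬ (K d ↔ K (M.rot d)) → Sum.inl (G.vert d) ∈ R := by
    intro d hd
    simp only [hK, M.vert_rot] at hd
    tauto
  have henter : ∀ d, ModArc.enter d ∈ M.boundary K → Sum.inl (G.vert d) ∈ R := by
    intro d hd
    obtain ⟨h1, h2⟩ : K d ∧ ¬ K (M.rot d) := mem_boundary.1 hd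
    exact hrot d fun h => h2 (h.1 h1)
  have hleave : ∀ d, ModArc.leave d ∈ M.boundary K → Sum.inl (G.vert d) ∈ R := by
    intro d hd
    obtain ⟨h1, h2⟩ : K (M.rot d) ∧ ¬ K d := mem_boundary.1 hd
    exact hrot d fun h => h2 (h.2 h1)
  obtain ⟨ds, hds⟩ := hconn.exists_dart G.s
  obtain ⟨dt, hdt⟩ := hconn.exists_dart G.t
  have hKs : K ds := .inl (by rw [hds]; exact ⟨_, hsS⟩)
  have hKt : ¬ K dt := by
    rintro (h | h)
    · rw [hdt] at h
      exact htS h.2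
    · rw [hdt] at h
      exact hR.t_notMem h.1
  obtain ⟨C, hCA, hC, ψ, hψ, hlt⟩ := (isPotential_boundary (M := M) K).exists_circuit_lt hconn
    (d := ds) (d' := dt) (by rw [ind_of_pos hKs, ind_of_neg hKt]; exact one_pos)
  have hvisit : ∀ v, G.Visits C v → Sum.inl v ∈ R := by
    rintro v ⟨d, rfl, h | h⟩
    · exact henter d (hCA h)
    · exact hleave d (hCA h)
  refine ⟨C, hC.isSTSeparatingCCW hconn (fun h => hR.s_notMem (hvisit _ h))
    (fun h => hR.t_notMem (hvisit _ h)) hψ hds hdt hlt, ?_⟩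
  -- Everything on the circuit is paid for, except the crossings of remaining arcs.
  set X := C.filter fun a => ∀ e, a = ModArc.dual e → Sum.inr e ∈ R
  have hcost : ∑ a ∈ X, G.modCost a ≤ (B : ℕ∞) := by
    refine (sum_le_sum_of_rel G.Removes (fun a ha hne => ?_) fun a ha a' ha' r h h' => ?_).trans hR
    · obtain ⟨haC, ha⟩ := Finset.mem_filter.1 ha
      cases a with
      | dual e => exact ⟨_, ha e rfl, .dual e, le_rfl⟩
      | enter d => exact ⟨_, henter d (hCA haC), .enter d, le_rfl⟩
      | dualRev e => exact absurd rfl hne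
      | leave d => exact absurd rfl hne
    · exact Removes.left_unique hC (Finset.mem_filter.1 ha).1 (Finset.mem_filter.1 ha').1 h h'
  have hlength : ∑ a ∈ C \ X, G.modLength a ≤
      ∑ e ∈ (G.remove R hR.s_notMem hR.t_notMem).cutArcs S, (G.u e.1 : ℕ∞) := by
    refine sum_le_sum_of_rel (fun a e => a = ModArc.dual e.1) (fun a ha _ => ?_)
      fun a _ a' _ e h h' => h.trans h'.symm
    obtain ⟨haC, haX⟩ := Finset.mem_sdiff.1 ha
    have : ∃ e, a = ModArc.dual e ∧ Sum.inr e ∉ R := by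
      by_contra! h
      exact haX (Finset.mem_filter.2 ⟨haC, h⟩)
    obtain ⟨e, rfl, he⟩ := this
    obtain ⟨⟨h1, h1S⟩, h2, h3⟩ := hdual e (hCA haC)
    refine ⟨⟨e, he, h1, h3⟩, ?_, rfl, le_rfl⟩
    simp only [cutArcs, Finset.mem_filter, Finset.mem_univ, true_and]
    exact ⟨h1S, fun h => h2 ⟨h3, h⟩⟩
  have hred : G.reducedLength B C ≤
      ((∑ e ∈ (G.remove R hR.s_notMem hR.t_notMem).cutArcs S, G.u e.1 : ℕ) : ℕ∞) := by
    rw [Nat.cast_sum]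
    exact le_trans (sInf_le ⟨X, Finset.filter_subset _ _, hcost, rfl⟩) hlength
  refine (EReal.coe_ennreal_le_coe_ennreal_iff.2 (ENat.toENNReal_le.2 hred)).trans ?_
  rw [natCast_toEReal, EReal.coe_le_coe_iff, Nat.cast_sum]
  exact hcut

/-- Removing what the circuit pays for with its budget leaves the vertices on the side of `s` as a
cut of `G ∖ R`, and the arcs that leave this cut are crossed by the rest of the circuit. -/
theorem exists_interdictionSet_maxFlow_le [Fintype V] [DecidableEq V] [Fintype E] [DecidableEq E]
    (hconn : G.toFlowNetwork.Connected) (M : G.toFlowNetwork.PlanarEmbedding) (B : ℕ)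
    {C : Finset (ModArc E)} (hC : M.IsSTSeparatingCCW C) :
    ∃ (R : Finset (V ⊕ E)) (hR : G.IsInterdictionSet B R),
      (((G.remove R hR.s_notMem hR.t_notMem).maxFlow : ℝ) : EReal) ≤
        ((G.reducedLength B C : ℝ≥0∞) : EReal) := by
  classical
  obtain ⟨X, hXC, hcost, hred⟩ := G.exists_reducedLength_eq B C
  rcases eq_or_ne (G.reducedLength B C) ⊤ with htop | htop
  · refine ⟨∅, by simp [IsInterdictionSet], ?_⟩
    simp [htop]
  obtain ⟨n, hn⟩ := ENat.ne_top_iff_exists.1 htop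
  -- Unpaid arcs into vertices would make the reduced length infinite.
  have henter : ∀ d, ModArc.enter d ∈ C → ModArc.enter d ∈ X := by
    intro d hd
    by_contra hdX
    refine htop (top_le_iff.1 ?_)
    rw [hred]
    exact Finset.single_le_sum (f := G.modLength) (fun _ _ => zero_le)
      (Finset.mem_sdiff.2 ⟨hd, hdX⟩)
  set R : Finset (V ⊕ E) := Finset.univ.filter fun r => ∃ a ∈ X, G.Removes a r with hRdef
  have hmemR : ∀ r, r ∈ R ↔ ∃ a ∈ X, G.Removes a r := by simp [hRdef]
  have hR : G.IsInterdictionSet B R := by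
    refine (sum_le_sum_of_rel (fun r a => G.Removes a r) (fun r hr _ => ?_)
      fun r _ r' _ a h h' => h.right_unique h').trans hcost
    obtain ⟨a, ha, har⟩ := (hmemR r).1 hr
    exact ⟨a, ha, har, har.modCost_eq.ge⟩
  have hvisit : ∀ v, G.Visits C v → Sum.inl v ∈ R := by
    have h : ∀ d, ModArc.enter d ∈ C → Sum.inl (G.vert d) ∈ R := fun d hd =>
      (hmemR _).2 ⟨_, henter d hd, .enter d⟩
    rintro v ⟨d, rfl, hd | hd⟩
    · exact h d hd
    · obtain ⟨a, ha, hhead⟩ := hC.1.exists_prev hd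
      cases a with
      | enter d' =>
        have : G.vert d' = G.vert d := Sum.inr_injective hhead
        exact this ▸ h d' ha
      | dual e => exact absurd hhead Sum.inl_ne_inr
      | dualRev e => exact absurd hhead Sum.inl_ne_inr
      | leave d => exact absurd hhead Sum.inl_ne_inr
  obtain ⟨ds, hds⟩ := hconn.exists_dart G.s
  set S : Finset (G.RemainingVertex R) :=
    Finset.univ.filter fun v => ∃ d, G.vert d = v.1 ∧ M.SameSide C ds d with hS
  have hmemS : ∀ v, v ∈ S ↔ ∃ d, G.vert d = v.1 ∧ M.SameSide C ds d := by simp [hS]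
  have hsS : (G.remove R hR.s_notMem hR.t_notMem).s ∈ S := (hmemS _).2 ⟨ds, hds, .refl ds⟩
  have htS : (G.remove R hR.s_notMem hR.t_notMem).t ∉ S := by
    intro h
    obtain ⟨d, hd, hsame⟩ := (hmemS _).1 h
    exact hC.2.2.2.2 ds d hds hd hsame
  refine ⟨R, hR, ?_⟩
  have hlength : ∑ e ∈ (G.remove R hR.s_notMem hR.t_notMem).cutArcs S, (G.u e.1 : ℕ∞) ≤
      ∑ a ∈ C \ X, G.modLength a := by
    refine sum_le_sum_of_rel (fun e a => a = ModArc.dual e.1) (fun e he _ => ?_)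
      fun e _ e' _ a h h' => Subtype.ext (ModArc.dual.inj (h.symm.trans h'))
    simp only [cutArcs, Finset.mem_filter, Finset.mem_univ, true_and] at he
    obtain ⟨htail, hhead⟩ := he
    obtain ⟨e, heR, htR, hhR⟩ := e
    have h1 : M.SameSide C ds (e, false) := by
      obtain ⟨d, hd, hsame⟩ := (hmemS _).1 htail
      have hd' : G.vert (e, false) = G.vert d := hd.symm
      refine .trans _ _ _ hsame (sameSide_of_not_visits (fun h => htR ?_) hd')
      have hv := hvisit _ h
      rw [hd] at hv
      exact hv
    have h2 : ¬ M.SameSide C ds (e, true) := fun h => hhead ((hmemS _).2 ⟨_, rfl, h⟩)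
    have hdualRev : ModArc.dualRev e ∉ C := fun h => h2 (hC.sides hconn hds h).1
    have hdual : ModArc.dual e ∈ C := by
      by_contra h
      exact h2 (.trans _ _ _ h1 (.rel _ _ (.inl ⟨rfl, h, hdualRev⟩)))
    exact ⟨.dual e, Finset.mem_sdiff.2 ⟨hdual, fun h => heR ((hmemR _).2 ⟨_, h, .dual e⟩)⟩, rfl,
      le_rfl⟩
  rw [← hred, ← hn, ← Nat.cast_sum, Nat.cast_le] at hlength
  rw [← hn, natCast_toEReal, EReal.coe_le_coe_iff]
  refine (maxFlow_le_cut hsS htS).trans ?_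
  rw [← Nat.cast_sum, Nat.cast_le]
  exact hlength

end InterdictionNetwork

theorem mainTheorem1 {V E : Type*} [Fintype V] [DecidableEq V] [Fintype E] [DecidableEq E]
    (G : InterdictionNetwork V E) (hconn : G.toFlowNetwork.Connected)
    (M : G.toFlowNetwork.PlanarEmbedding) (B : ℕ) :
    (∀ (R : Finset (V ⊕ E)) (hR : G.IsInterdictionSet B R),
      ∃ C : Finset (ModArc E), M.IsSTSeparatingCCW C ∧
        ((G.reducedLength B C : ℝ≥0∞) : EReal) ≤
          (((G.remove R hR.s_notMem hR.t_notMem).maxFlow : ℝ) : EReal)) ∧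
    (∀ C : Finset (ModArc E), M.IsSTSeparatingCCW C →
      ∃ (R : Finset (V ⊕ E)) (hR : G.IsInterdictionSet B R),
        (((G.remove R hR.s_notMem hR.t_notMem).maxFlow : ℝ) : EReal) ≤
          ((G.reducedLength B C : ℝ≥0∞) : EReal)) :=
  ⟨fun _ hR => G.exists_circuit_le_maxFlow hconn M hR,
    fun _ hC => G.exists_interdictionSet_maxFlow_le hconn M B hC⟩
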